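/- Let $k,p,M$ be fixed, let $\phi:\mathbb{R}^p\to\mathbb{R}$ be differentiable and convex, with Bregman divergence $d_\phi(x,y)=\phi(x)-\phi(y)-\langle\nabla\phi(y),x-y\rangle$, and let $\Psi:\mathbb{R}_{\ge0}^k\to\mathbb{R}_{\ge0}$ be componentwise non-decreasing with $\Psi(0)=0$. For $\Theta=(\theta_1,\dots,\theta_k)\in\mathbb{R}^{k\times p}$ (with rows $\theta_j$) put $f_\Theta(x)=\Psi(d_\phi(x,\theta_1),\dots,d_\phi(x,\theta_k))$, and for a probability measure $Q$ put $Qf_\Theta=\int f_\Theta\,dQ$. Let $\operatorname{diss}(\Theta_1,\Theta_2)=\min_{\Pi}\|\Theta_1-\Pi\,\Theta_2\|_F$, the minimum being over all $k\times k$ permutation matrices $\Pi$. Assume: 1. $X_1,X_2,\dots$ are i.i.d. with law $P$, and $P([-M,M]^p)=1$; 2. there is $\tau$ such that $|\Psi(x)-\Psi(y)|\le\tau\|x-y\|_1$ for all $x,y\in\mathbb{R}_{\ge0}^k$; 3. there is $H\ge0$ such that $\|\nabla\phi(x)-\nabla\phi(y)\|_2\le H\|x-y\|_2$ for all $x,y\in[-M,M]^p$;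 4. $\Theta^\ast$ is a global minimizer of $\Theta\mapsto Pf_\Theta$ over $\mathbb{R}^{k\times p}$, and for every $\eta>0$ there is $\epsilon>0$ such that $Pf_\Theta>Pf_{\Theta^\ast}+\epsilon$ for every $\Theta\in\mathbb{R}^{k\times p}$ with $\operatorname{diss}(\Theta,\Theta^\ast)>\eta$. For each $n$ let $\widehat\Theta_n$ be a (measurable) global minimizer over $\mathbb{R}^{k\times p}$ of the empirical risk $P_nf_\Theta=\frac1n\sum_{i=1}^n f_\Theta(X_i)$. Then $\operatorname{diss}(\widehat\Theta_n,\Theta^\ast)\to0$ almost surely. Moreover $|Pf_{\widehat\Theta_n}-Pf_{\Theta^\ast}|=O_P(n^{-1/2})$, that is, the sequence $\sqrt n\,|Pf_{\widehat\Theta_n}-Pf_{\Theta^\ast}|$ is tight. -/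

import Mathlib

open MeasureTheory ProbabilityTheory Filter Topology

noncomputable section

namespace CenterClustering

/-- The Bregman divergence `d_φ(x, y) = φ(x) - φ(y) - ⟨∇φ(y), x - y⟩`. -/
def bregman {p : ℕ} (φ : EuclideanSpace ℝ (Fin p) → ℝ) (x y : EuclideanSpace ℝ (Fin p)) : ℝ :=
  φ x - φ y - inner ℝ (gradient φ y) (x - y)

/-- The cube `[-M, M]^p`. -/
def cube (p : ℕ) (M : ℝ) : Set (EuclideanSpace ℝ (Fin p)) :=
  {x | ∀ i, x i ∈ Set.Icc (-M) M}

/-- `Ψ` restricts to a componentwise non-decreasing map from the nonnegative orthant of `ℝ^k`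
to `[0, ∞)` that vanishes at the origin. Its values off the orthant play no role. -/
structure IsAggregation {k : ℕ} (Ψ : (Fin k → ℝ) → ℝ) : Prop where
  nonneg : ∀ x, 0 ≤ x → 0 ≤ Ψ x
  mono : ∀ x y, 0 ≤ x → x ≤ y → Ψ x ≤ Ψ y
  zero : Ψ 0 = 0

/-- The loss `f_Θ(x) = Ψ(d_φ(x, θ₁), …, d_φ(x, θ_k))`; the centroid `θ_j` is the row `Θ j`. -/
def loss {k p : ℕ} (Ψ : (Fin k → ℝ) → ℝ) (φ : EuclideanSpace ℝ (Fin p) → ℝ)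
    (Θ : Fin k → EuclideanSpace ℝ (Fin p)) (x : EuclideanSpace ℝ (Fin p)) : ℝ :=
  Ψ fun j => bregman φ x (Θ j)

/-- The population risk `P f_Θ = ∫ f_Θ dP`. -/
def risk {k p : ℕ} (Ψ : (Fin k → ℝ) → ℝ) (φ : EuclideanSpace ℝ (Fin p) → ℝ)
    (P : Measure (EuclideanSpace ℝ (Fin p))) (Θ : Fin k → EuclideanSpace ℝ (Fin p)) : ℝ :=
  ∫ x, loss Ψ φ Θ x ∂P

/-- The empirical risk `P_n f_Θ = (1/n) ∑_{i < n} f_Θ(x_i)` of the first `n` data points. -/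
def empRisk {k p : ℕ} (Ψ : (Fin k → ℝ) → ℝ) (φ : EuclideanSpace ℝ (Fin p) → ℝ)
    (n : ℕ) (x : ℕ → EuclideanSpace ℝ (Fin p)) (Θ : Fin k → EuclideanSpace ℝ (Fin p)) : ℝ :=
  (n : ℝ)⁻¹ * ∑ i ∈ Finset.range n, loss Ψ φ Θ (x i)

/-- The Frobenius distance between centroid matrices, minimized over permutations of the rows
of the second one. -/
def diss {k p : ℕ} (Θ₁ Θ₂ : Fin k → EuclideanSpace ℝ (Fin p)) : ℝ :=
  ⨅ σ : Equiv.Perm (Fin k), √(∑ j, ‖Θ₁ j - Θ₂ (σ j)‖ ^ 2)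

/-- `X_n = O_P(a_n)`: the sequence `X_n / a_n` is tight. -/
def IsBigOP {Ω : Type*} [MeasurableSpace Ω] (μ : Measure Ω) (X : ℕ → Ω → ℝ) (a : ℕ → ℝ) : Prop :=
  ∀ δ : ℝ, 0 < δ → ∃ C : ℝ, ∀ n, μ {ω | C < |X n ω / a n|} ≤ ENNReal.ofReal δ

end CenterClustering

end

/-!
# Consistency and the parametric rate for clustering with Bregman divergences

As a function of `x`, the divergence `d_φ(x, θ)` is `φ x` minus the tangent of `φ` at `θ`. The loss
therefore depends on the centroids only through the coefficients of `k` affine functions, and the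
empirical process is indexed by a finite-dimensional parameter in which the loss is Lipschitz,
uniformly on the support of `P` (`affineLoss`, `isLipschitzClass_affineLoss`).

The centroids range over an unbounded set. Since `φ` is convex on the whole space, a tangent either
has bounded coefficients or lies far below `φ` on the whole support
(`exists_forall_norm_tangentCoeff_le_or`). In the second case the centroid may be replaced by a
fixed point `θ₀` far from all the true centroids without increasing the loss. The parameter so
modified has bounded coefficients, where the law of large numbers is uniform; identifiability then
places it near the true centroids, so that nothing was replaced and the empirical minimizer itself
is near them (`ae_tendsto_diss`).

For the rate, `√n` times the excess risk is at most an increment of the empirical process between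
the empirical and the population minimizer (`sqrt_mul_risk_sub_le`), both of which have bounded
coefficients with high probability. By Hoeffding's inequality the increments of the empirical
process have exponential tails on the scale of the distance of the parameters, with constants free
of `n`, and chaining along dyadic grids bounds them uniformly over a box
(`exists_forall_measure_exists_lt_abs_sub_le`). The finitely many small sample sizes are tight
because the risk of a measurable estimator is a real random variable (`isBigOP_of_eventually`).
-/

namespace CenterClustering

/-! ### Chaining along dyadic grids -/

/-- The point of the grid `2⁻ᵐ ℤ^ι` obtained from `l` by rounding every coordinate down. -/
noncomputable def dyadicFloor {ι : Type*} (m : ℕ) (l : ι → ℝ) : ι → ℝ :=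
  fun i => (⌊l i * 2 ^ m⌋ : ℝ) / 2 ^ m

lemma norm_dyadicFloor_sub_le {ι : Type*} [Fintype ι] (m : ℕ) (l : ι → ℝ) :
    ‖dyadicFloor m l - l‖ ≤ (1 / 2 : ℝ) ^ m := by
  refine (pi_norm_le_iff_of_nonneg (by positivity)).2 fun i => ?_
  have h2 : (0 : ℝ) < 2 ^ m := by positivity
  have h : dyadicFloor m l i - l i = ((⌊l i * 2 ^ m⌋ : ℝ) - l i * 2 ^ m) / 2 ^ m := by
    simp only [dyadicFloor]; field_simp
  rw [Pi.sub_apply, h, Real.norm_eq_abs, abs_div, abs_of_pos h2, one_div, inv_pow,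
    div_le_iff₀ h2, inv_mul_cancel₀ h2.ne', abs_le]
  constructor <;> linarith [Int.floor_le (l i * 2 ^ m), Int.lt_floor_add_one (l i * 2 ^ m)]

/-- The points of the grid `2⁻ᵐ ℤ^ι` in the box `[-R, R]^ι`. -/
noncomputable def dyadicGrid (ι : Type*) [Fintype ι] [DecidableEq ι] (R m : ℕ) :
    Finset (ι → ℝ) :=
  Fintype.piFinset fun _ =>
    (Finset.Icc (-(R * 2 ^ m : ℕ) : ℤ) (R * 2 ^ m : ℕ)).image fun z : ℤ => (z : ℝ) / 2 ^ m

lemma dyadicFloor_mem_dyadicGrid {ι : Type*} [Fintype ι] [DecidableEq ι] {R : ℕ} (m : ℕ)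
    {l : ι → ℝ} (hl : ‖l‖ ≤ R) : dyadicFloor m l ∈ dyadicGrid ι R m := by
  refine Fintype.mem_piFinset.2 fun i => Finset.mem_image.2 ⟨⌊l i * 2 ^ m⌋, ?_, rfl⟩
  have h2 : (0 : ℝ) < 2 ^ m := by positivity
  have hi := abs_le.1 ((norm_le_pi_norm l i).trans hl)
  rw [Finset.mem_Icc]
  constructor
  · rw [Int.le_floor]; push_cast; nlinarith
  · have : (⌊l i * 2 ^ m⌋ : ℝ) ≤ ((R * 2 ^ m : ℕ) : ℤ) :=
      (Int.floor_le _).trans (by push_cast; nlinarith)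
    exact_mod_cast this

lemma card_dyadicGrid_le (ι : Type*) [Fintype ι] [DecidableEq ι] {R : ℕ} (hR : 1 ≤ R) (m : ℕ) :
    (dyadicGrid ι R m).card ≤ ((6 * R) ^ (m + 1)) ^ Fintype.card ι := by
  rw [dyadicGrid, Fintype.card_piFinset, Finset.prod_const, Finset.card_univ]
  refine Nat.pow_le_pow_left (Finset.card_image_le.trans ?_) _
  rw [Int.card_Icc]
  have h1 : 1 ≤ R * 2 ^ m := Nat.mul_pos hR (by positivity)
  have h2 : 3 * (R * 2 ^ m) ≤ (6 * R) ^ (m + 1) := by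
    have : 2 ^ m ≤ (6 * R) ^ m := Nat.pow_le_pow_left (by omega) m
    rw [pow_succ]; nlinarith
  omega

/-- Coarsest-to-finest approximations of `l`: the origin first, then the dyadic roundings. -/
noncomputable def dyadicApprox {ι : Type*} (l : ι → ℝ) : ℕ → ι → ℝ
  | 0 => 0
  | m + 1 => dyadicFloor m l

/-- The finite set in which the `m`-th approximation of a point of `[-R, R]^ι` lies. -/
noncomputable def dyadicNet (ι : Type*) [Fintype ι] [DecidableEq ι] (R : ℕ) :
    ℕ → Finset (ι → ℝ)
  | 0 => {0}
  | m + 1 => dyadicGrid ι R m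

lemma dyadicApprox_mem_dyadicNet {ι : Type*} [Fintype ι] [DecidableEq ι] {R : ℕ}
    {l : ι → ℝ} (hl : ‖l‖ ≤ R) (m : ℕ) : dyadicApprox l m ∈ dyadicNet ι R m := by
  cases m with
  | zero => simp [dyadicApprox, dyadicNet]
  | succ m => exact dyadicFloor_mem_dyadicGrid m hl

lemma card_dyadicNet_le (ι : Type*) [Fintype ι] [DecidableEq ι] {R : ℕ} (hR : 1 ≤ R) (m : ℕ) :
    (dyadicNet ι R m).card ≤ ((6 * R) ^ m) ^ Fintype.card ι := by
  cases m with
  | zero => simp [dyadicNet]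
  | succ m => exact card_dyadicGrid_le ι hR m

lemma tendsto_dyadicApprox {ι : Type*} [Fintype ι] (l : ι → ℝ) :
    Tendsto (dyadicApprox l) atTop (𝓝 l) := by
  rw [← tendsto_add_atTop_iff_nat 1, tendsto_iff_norm_sub_tendsto_zero]
  exact squeeze_zero (fun _ => norm_nonneg _) (fun m => norm_dyadicFloor_sub_le m l)
    (tendsto_pow_atTop_nhds_zero_of_lt_one (by norm_num) (by norm_num))

lemma norm_dyadicApprox_succ_sub_le {ι : Type*} [Fintype ι] {R : ℕ} {l : ι → ℝ}
    (hl : ‖l‖ ≤ R) (m : ℕ) :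
    ‖dyadicApprox l (m + 1) - dyadicApprox l m‖ ≤ (R + 3) * (1 / 2 : ℝ) ^ m := by
  have h1 := norm_dyadicFloor_sub_le m l
  cases m with
  | zero =>
    have := norm_le_norm_add_norm_sub' (dyadicFloor 0 l) l
    simp only [dyadicApprox, sub_zero, pow_zero, mul_one] at *
    linarith
  | succ m =>
    have h2 := norm_dyadicFloor_sub_le m l
    have h3 := norm_sub_le_norm_sub_add_norm_sub (dyadicFloor (m + 1) l) l (dyadicFloor m l)
    rw [norm_sub_rev l] at h3
    have h4 : (0 : ℝ) ≤ R * (1 / 2 : ℝ) ^ (m + 1) := by positivity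
    simp only [dyadicApprox]
    rw [pow_succ] at *
    linarith

lemma sum_succ_mul_half_pow_le (n : ℕ) :
    ∑ m ∈ Finset.range n, ((m : ℝ) + 1) * (1 / 2) ^ m ≤ 4 := by
  have h : ∑ m ∈ Finset.range n, ((m : ℝ) + 1) * (1 / 2) ^ m
      = 4 - 2 * (n + 2) * (1 / 2) ^ n := by
    induction n with
    | zero => norm_num
    | succ n ih => rw [Finset.sum_range_succ, ih, pow_succ]; push_cast; ring
  rw [h]
  have : (0 : ℝ) ≤ 2 * (n + 2) * (1 / 2) ^ n := by positivity
  linarith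

/-- If all the increments along the links of the dyadic nets are controlled, so is the whole
continuous path. -/
lemma abs_sub_le_of_links {ι : Type*} [Fintype ι] [DecidableEq ι] {R : ℕ} {y : (ι → ℝ) → ℝ}
    (hy : Continuous y) {K s : ℝ} (hK : 0 ≤ K) (hs : 0 ≤ s)
    (h : ∀ m, ∀ u ∈ dyadicNet ι R m, ∀ v ∈ dyadicNet ι R (m + 1),
      |y v - y u| ≤ (m + 1) * s * (K * ‖v - u‖)) {l : ι → ℝ} (hl : ‖l‖ ≤ R) :
    |y l - y 0| ≤ 4 * (s * K * (R + 3)) := by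
  have hlim : Tendsto (fun n => |y (dyadicApprox l n) - y 0|) atTop (𝓝 |y l - y 0|) :=
    (((hy.tendsto l).comp (tendsto_dyadicApprox l)).sub_const _).abs
  refine le_of_tendsto' hlim fun n => ?_
  have htel : y (dyadicApprox l n) - y 0
      = ∑ m ∈ Finset.range n, (y (dyadicApprox l (m + 1)) - y (dyadicApprox l m)) := by
    rw [Finset.sum_range_sub (fun m => y (dyadicApprox l m))]; rfl
  rw [htel]
  calc _ ≤ ∑ m ∈ Finset.range n, |y (dyadicApprox l (m + 1)) - y (dyadicApprox l m)| :=
        Finset.abs_sum_le_sum_abs _ _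
    _ ≤ ∑ m ∈ Finset.range n, (s * K * (R + 3)) * (((m : ℝ) + 1) * (1 / 2) ^ m) := by
        refine Finset.sum_le_sum fun m _ => ?_
        refine (h m _ (dyadicApprox_mem_dyadicNet hl m) _
          (dyadicApprox_mem_dyadicNet hl (m + 1))).trans ?_
        calc _ ≤ (m + 1) * s * (K * ((R + 3) * (1 / 2 : ℝ) ^ m)) := by
              gcongr; exact norm_dyadicApprox_succ_sub_le hl m
          _ = _ := by ring
    _ ≤ _ := by
        rw [← Finset.mul_sum, mul_comm 4]
        exact mul_le_mul_of_nonneg_left (sum_succ_mul_half_pow_le n) (by positivity)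

/-- Chaining: a process indexed by `ℝ^ι` with continuous paths whose increments have exponential
tails on the scale of the distance is bounded on boxes, with high probability. The bound `C`
depends on the tail parameter `K` and not on the process. -/
theorem exists_forall_measure_exists_lt_abs_sub_le (ι : Type*) [Fintype ι] {Ω : Type*}
    [MeasurableSpace Ω] (μ : Measure Ω) {K : ℝ} (hK : 0 ≤ K) {R : ℕ} (hR : 1 ≤ R)
    {δ : ℝ} (hδ : 0 < δ) :
    ∃ C : ℝ, ∀ Y : (ι → ℝ) → Ω → ℝ, (∀ᵐ ω ∂μ, Continuous fun l => Y l ω) →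
      (∀ u v t, 0 ≤ t → μ {ω | t * (K * ‖v - u‖) < |Y v ω - Y u ω|}
        ≤ ENNReal.ofReal (4 * Real.exp (-t))) →
      μ {ω | ∃ l, ‖l‖ ≤ R ∧ C < |Y l ω - Y 0 ω|} ≤ ENNReal.ofReal δ := by
  classical
  -- `Q ^ (m + 1)` bounds the number of links at level `m`; the scale `s` is chosen so that the
  -- failure probabilities of the levels are dominated by the geometric series of ratio `q`.
  set Q : ℝ := ((6 * R : ℕ) : ℝ) ^ (2 * Fintype.card ι) with hQ
  have hQ1 : 1 ≤ Q := one_le_pow₀ (by exact_mod_cast (by omega : 1 ≤ 6 * R))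
  obtain ⟨q, hq0, hq2, hqδ⟩ : ∃ q : ℝ, 0 < q ∧ q ≤ 1 / 2 ∧ 8 * q ≤ δ :=
    ⟨min (1 / 2) (δ / 8), by positivity, min_le_left _ _, by
      linarith [min_le_right (1 / 2) (δ / 8)]⟩
  set s : ℝ := Real.log (Q / q) with hs_def
  have hQq : 0 < Q / q := by positivity
  have hs : 0 ≤ s := Real.log_nonneg (by rw [le_div_iff₀ hq0]; linarith)
  have hsq : Q * Real.exp (-s) = q := by
    rw [Real.exp_neg, hs_def, Real.exp_log hQq]; field_simp
  refine ⟨4 * (s * K * (R + 3)), fun Y hY hinc => ?_⟩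
  set bad : ℕ → Set Ω := fun m => ⋃ u ∈ dyadicNet ι R m, ⋃ v ∈ dyadicNet ι R (m + 1),
    {ω | (m + 1) * s * (K * ‖v - u‖) < |Y v ω - Y u ω|} with hbad
  have hsub : {ω | ∃ l, ‖l‖ ≤ R ∧ 4 * (s * K * (R + 3)) < |Y l ω - Y 0 ω|}
      ≤ᵐ[μ] ⋃ m, bad m := by
    filter_upwards [hY] with ω hω hmem
    obtain ⟨l, hl, hlt⟩ := hmem
    by_contra hnot
    refine absurd (abs_sub_le_of_links hω hK hs (fun m u hu v hv => ?_) hl) (not_le.2 hlt)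
    by_contra hlt'
    refine hnot (Set.mem_iUnion.2 ⟨m, ?_⟩)
    simp only [hbad, Set.mem_iUnion]
    exact ⟨u, hu, v, hv, not_le.1 hlt'⟩
  have hlevel : ∀ m, μ (bad m) ≤ ENNReal.ofReal (4 * q ^ (m + 1)) := by
    intro m
    have hc : ((dyadicNet ι R m).card : ℝ) * (dyadicNet ι R (m + 1)).card ≤ Q ^ (m + 1) := by
      have h1 := card_dyadicNet_le ι hR m
      have h2 := card_dyadicNet_le ι hR (m + 1)
      have h3 : ((6 * R) ^ m) ^ Fintype.card ι ≤ ((6 * R) ^ (m + 1)) ^ Fintype.card ι :=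
        Nat.pow_le_pow_left (Nat.pow_le_pow_right (by omega) (by omega)) _
      calc ((dyadicNet ι R m).card : ℝ) * (dyadicNet ι R (m + 1)).card
          ≤ ((((6 * R) ^ (m + 1)) ^ Fintype.card ι * ((6 * R) ^ (m + 1)) ^ Fintype.card ι : ℕ)
            : ℝ) := by exact_mod_cast Nat.mul_le_mul (h1.trans h3) h2
        _ = Q ^ (m + 1) := by rw [hQ]; push_cast; ring
    calc μ (bad m)
        ≤ ∑ u ∈ dyadicNet ι R m, ∑ v ∈ dyadicNet ι R (m + 1),
            ENNReal.ofReal (4 * Real.exp (-((m + 1) * s))) :=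
          (measure_biUnion_finset_le _ _).trans <| Finset.sum_le_sum fun u _ =>
            (measure_biUnion_finset_le _ _).trans <| Finset.sum_le_sum fun v _ =>
              hinc u v _ (by positivity)
      _ = ENNReal.ofReal (((dyadicNet ι R m).card : ℝ) * (dyadicNet ι R (m + 1)).card
            * (4 * Real.exp (-((m + 1) * s)))) := by
          rw [ENNReal.ofReal_mul (by positivity), ENNReal.ofReal_mul (by positivity)]
          simp [mul_assoc]
      _ ≤ ENNReal.ofReal (4 * q ^ (m + 1)) := by
          refine ENNReal.ofReal_le_ofReal ?_
          calc _ ≤ Q ^ (m + 1) * (4 * Real.exp (-((m + 1) * s))) := by gcongr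
            _ = 4 * q ^ (m + 1) := by
              have : Real.exp (-((m + 1) * s)) = Real.exp (-s) ^ (m + 1) := by
                rw [← Real.exp_nat_mul]; congr 1; push_cast; ring
              rw [← hsq, mul_pow, this]; ring
  have hgeom : HasSum (fun m : ℕ => 4 * q ^ (m + 1)) (4 * q * (1 - q)⁻¹) := by
    have := (hasSum_geometric_of_lt_one hq0.le (by linarith)).mul_left (4 * q)
    simpa [pow_succ, mul_assoc, mul_comm, mul_left_comm] using this
  calc _ ≤ μ (⋃ m, bad m) := measure_mono_ae hsub
    _ ≤ ∑' m, μ (bad m) := measure_iUnion_le _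
    _ ≤ ∑' m : ℕ, ENNReal.ofReal (4 * q ^ (m + 1)) := ENNReal.tsum_le_tsum hlevel
    _ = ENNReal.ofReal (4 * q * (1 - q)⁻¹) := by
        rw [← ENNReal.ofReal_tsum_of_nonneg (fun m => by positivity) hgeom.summable,
          hgeom.tsum_eq]
    _ ≤ ENNReal.ofReal δ := by
        refine ENNReal.ofReal_le_ofReal (le_trans ?_ hqδ)
        rw [← div_eq_mul_inv, div_le_iff₀ (by linarith)]
        nlinarith

/-! ### Empirical processes of Lipschitz classes -/

/-- The empirical process `√n (P_n - P) g_l`, indexed by the parameter `l` of the class `g`. -/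
noncomputable def empFluct {Λ E Ω : Type*} [MeasurableSpace E] (g : Λ → E → ℝ) (P : Measure E)
    (X : ℕ → Ω → E) (n : ℕ) (l : Λ) (ω : Ω) : ℝ :=
  (√n)⁻¹ * ∑ i ∈ Finset.range n, (g l (X i ω) - ∫ x, g l x ∂P)

/-- Hoeffding's inequality, with the Gaussian tail weakened to an exponential one, which suffices
for chaining. -/
lemma measure_lt_abs_normalized_sum_le {E Ω : Type*} [MeasurableSpace E] [MeasurableSpace Ω]
    {μ : Measure Ω} [IsProbabilityMeasure μ] {P : Measure E} {X : ℕ → Ω → E}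
    (hlaw : ∀ i, HasLaw (X i) P μ) (hindep : iIndepFun X μ) {h : E → ℝ} (hm : Measurable h)
    {b : ℝ} (hb : 0 < b) (hbd : ∀ᵐ x ∂P, |h x| ≤ b) (n : ℕ) {t : ℝ} (ht : 0 ≤ t) :
    μ {ω | t * (2 * b) < |(√n)⁻¹ * ∑ i ∈ Finset.range n, (h (X i ω) - ∫ x, h x ∂P)|}
      ≤ ENNReal.ofReal (4 * Real.exp (-t)) := by
  rcases Nat.eq_zero_or_pos n with rfl | hn
  · have : {ω : Ω | t * (2 * b) < |(√((0 : ℕ) : ℝ))⁻¹ *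
        ∑ i ∈ Finset.range 0, (h (X i ω) - ∫ x, h x ∂P)|} = ∅ := by
      ext ω
      simpa using by positivity
    rw [this]; simp
  have hn0 : (0 : ℝ) < n := by exact_mod_cast hn
  have hsn : 0 < √(n : ℝ) := Real.sqrt_pos.2 hn0
  set Z : ℕ → Ω → ℝ := fun i ω => h (X i ω) - ∫ x, h x ∂P with hZ
  have hZind : iIndepFun Z μ :=
    hindep.comp (fun _ x => h x - ∫ x, h x ∂P) fun _ => hm.sub_const _
  have hsub : ∀ i, HasSubgaussianMGF (Z i) (b.toNNReal ^ 2) μ := by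
    intro i
    have hbi : ∀ᵐ ω ∂μ, h (X i ω) ∈ Set.Icc (-b) b := by
      have : ∀ᵐ x ∂(μ.map (X i)), |h x| ≤ b := by rw [(hlaw i).map_eq]; exact hbd
      filter_upwards [ae_of_ae_map (hlaw i).aemeasurable this] with ω hω using abs_le.1 hω
    have := hasSubgaussianMGF_of_mem_Icc (hm.comp_aemeasurable (hlaw i).aemeasurable) hbi
    have hint : ∫ ω, (h ∘ X i) ω ∂μ = ∫ x, h x ∂P :=
      (hlaw i).integral_comp hm.aestronglyMeasurable
    rw [hint] at this
    have hc : (‖b - -b‖₊ / 2) ^ 2 = b.toNNReal ^ 2 := by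
      ext
      rw [NNReal.coe_pow, NNReal.coe_pow, NNReal.coe_div, coe_nnnorm, Real.norm_eq_abs,
        NNReal.coe_ofNat, Real.coe_toNNReal _ hb.le, sub_neg_eq_add,
        abs_of_pos (by linarith)]
      ring
    rw [hc] at this
    exact this
  have htail : ∀ W : ℕ → Ω → ℝ, iIndepFun W μ →
      (∀ i, HasSubgaussianMGF (W i) (b.toNNReal ^ 2) μ) →
      μ {ω | √n * (t * (2 * b)) ≤ ∑ i ∈ Finset.range n, W i ω}
        ≤ ENNReal.ofReal (2 * Real.exp (-t)) := by
    intro W hW hWs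
    rw [← ofReal_measureReal]
    refine ENNReal.ofReal_le_ofReal ?_
    refine (HasSubgaussianMGF.measure_sum_range_ge_le_of_iIndepFun hW (fun i _ => hWs i)
      (by positivity)).trans ?_
    have : -(√n * (t * (2 * b))) ^ 2 / (2 * n * b ^ 2) = -(2 * t ^ 2) := by
      rw [mul_pow, Real.sq_sqrt hn0.le]; field_simp
    rw [NNReal.coe_pow, Real.coe_toNNReal _ hb.le, this]
    rcases le_total t (1 / 2) with h1 | h1
    · have h2 : Real.exp (-(2 * t ^ 2)) ≤ 1 := Real.exp_le_one_iff.2 (by nlinarith)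
      have h3 := Real.add_one_le_exp (-t)
      linarith
    · have h2 : Real.exp (-(2 * t ^ 2)) ≤ Real.exp (-t) := Real.exp_le_exp.2 (by nlinarith)
      linarith [Real.exp_pos (-t)]
  calc _ ≤ μ ({ω | √n * (t * (2 * b)) ≤ ∑ i ∈ Finset.range n, Z i ω} ∪
        {ω | √n * (t * (2 * b)) ≤ ∑ i ∈ Finset.range n, (-Z i) ω}) := by
        refine measure_mono fun ω hω => ?_
        simp only [Set.mem_ofPred_eq, abs_mul, abs_of_pos (inv_pos.2 hsn)] at hω
        rw [inv_mul_eq_div, lt_div_iff₀ hsn, mul_comm] at hω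
        simp only [Set.mem_union, Set.mem_ofPred_eq, Pi.neg_apply, Finset.sum_neg_distrib]
        exact le_abs.1 hω.le
    _ ≤ ENNReal.ofReal (2 * Real.exp (-t)) + ENNReal.ofReal (2 * Real.exp (-t)) :=
        (measure_union_le _ _).trans (add_le_add (htail Z hZind hsub)
          (htail (fun i => -Z i) (hZind.comp (fun _ x => -x) fun _ => measurable_neg)
            fun i => (hsub i).neg))
    _ = _ := by rw [← ENNReal.ofReal_add (by positivity) (by positivity)]; ring_nf

/-- A class of functions on `E` parametrized by `ℝ^ι`, integrable for `P` and Lipschitz in the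
parameter, uniformly on a set of full measure. The constant `L` is taken positive so that
Hoeffding's inequality has a nonzero range to divide by. -/
structure IsLipschitzClass {ι E : Type*} [Fintype ι] [MeasurableSpace E] (g : (ι → ℝ) → E → ℝ)
    (P : Measure E) (L : ℝ) : Prop where
  pos : 0 < L
  measurable : ∀ l, Measurable (g l)
  integrable : ∀ l, Integrable (g l) P
  lipschitz : ∀ᵐ x ∂P, ∀ u v, |g v x - g u x| ≤ L * ‖v - u‖

section

variable {ι E Ω : Type*} [Fintype ι] [MeasurableSpace E] [MeasurableSpace Ω]
  {g : (ι → ℝ) → E → ℝ} {P : Measure E} {L : ℝ} {μ : Measure Ω} {X : ℕ → Ω → E}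

lemma IsLipschitzClass.abs_integral_sub_le [IsProbabilityMeasure P]
    (hg : IsLipschitzClass g P L) (u v : ι → ℝ) :
    |∫ x, g v x ∂P - ∫ x, g u x ∂P| ≤ L * ‖v - u‖ := by
  rw [← integral_sub (hg.integrable v) (hg.integrable u)]
  have := norm_integral_le_of_norm_le_const (μ := P) (f := fun x => g v x - g u x)
    (C := L * ‖v - u‖) (by filter_upwards [hg.lipschitz] with x hx using hx u v)
  simpa using this

lemma continuous_of_abs_sub_le {ι : Type*} [Fintype ι] {y : (ι → ℝ) → ℝ} {L : ℝ}
    (h : ∀ u v, |y v - y u| ≤ L * ‖v - u‖) : Continuous y :=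
  (LipschitzWith.of_dist_le' (K := L) fun u v => by
    simpa [dist_eq_norm] using h v u).continuous

lemma IsLipschitzClass.ae_forall_lipschitz (hg : IsLipschitzClass g P L)
    (hlaw : ∀ i, HasLaw (X i) P μ) :
    ∀ᵐ ω ∂μ, ∀ i u v, |g v (X i ω) - g u (X i ω)| ≤ L * ‖v - u‖ := by
  refine ae_all_iff.2 fun i => ae_of_ae_map (hlaw i).aemeasurable
    (p := fun x => ∀ u v, |g v x - g u x| ≤ L * ‖v - u‖) ?_
  rw [(hlaw i).map_eq]
  exact hg.lipschitz

lemma IsLipschitzClass.ae_continuous_empFluct [IsProbabilityMeasure P]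
    (hg : IsLipschitzClass g P L) (hlaw : ∀ i, HasLaw (X i) P μ) (n : ℕ) :
    ∀ᵐ ω ∂μ, Continuous fun l => empFluct g P X n l ω := by
  filter_upwards [hg.ae_forall_lipschitz hlaw] with ω hω
  unfold empFluct
  refine continuous_const.mul (continuous_finsetSum _ fun i _ => ?_)
  exact (continuous_of_abs_sub_le (hω i)).sub (continuous_of_abs_sub_le hg.abs_integral_sub_le)

lemma IsLipschitzClass.measure_lt_abs_empFluct_sub_le [IsProbabilityMeasure μ]
    [IsProbabilityMeasure P] (hg : IsLipschitzClass g P L) (hlaw : ∀ i, HasLaw (X i) P μ)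
    (hindep : iIndepFun X μ) (n : ℕ) (u v : ι → ℝ) {t : ℝ} (ht : 0 ≤ t) :
    μ {ω | t * ((2 * L) * ‖v - u‖) < |empFluct g P X n v ω - empFluct g P X n u ω|}
      ≤ ENNReal.ofReal (4 * Real.exp (-t)) := by
  rcases eq_or_ne v u with rfl | hne
  · simp
  have := measure_lt_abs_normalized_sum_le hlaw hindep
    ((hg.measurable v).sub (hg.measurable u)) (b := L * ‖v - u‖)
    (mul_pos hg.pos (norm_pos_iff.2 (sub_ne_zero.2 hne)))
    (by filter_upwards [hg.lipschitz] with x hx using hx u v) n ht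
  convert this using 6 with ω
  · ring
  · rw [empFluct, empFluct, ← mul_sub, ← Finset.sum_sub_distrib]
    simp only [Pi.sub_apply]
    rw [integral_sub (hg.integrable v) (hg.integrable u)]
    congr 1
    exact Finset.sum_congr rfl fun i _ => by ring

/-- The centred empirical process of a Lipschitz class is bounded on boxes, with high
probability and uniformly in the sample size. -/
theorem IsLipschitzClass.exists_forall_measure_exists_lt_abs_empFluct_sub_le
    [IsProbabilityMeasure μ] [IsProbabilityMeasure P] (hg : IsLipschitzClass g P L)
    (hlaw : ∀ i, HasLaw (X i) P μ) (hindep : iIndepFun X μ) {R : ℕ} (hR : 1 ≤ R) {δ : ℝ}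
    (hδ : 0 < δ) :
    ∃ C : ℝ, ∀ n, μ {ω | ∃ l, ‖l‖ ≤ R ∧ C < |empFluct g P X n l ω - empFluct g P X n 0 ω|}
      ≤ ENNReal.ofReal δ := by
  obtain ⟨C, hC⟩ := exists_forall_measure_exists_lt_abs_sub_le ι μ
    (by linarith [hg.pos] : 0 ≤ 2 * L) hR hδ
  exact ⟨C, fun n => hC (empFluct g P X n) (hg.ae_continuous_empFluct hlaw n)
    fun u v t ht => hg.measure_lt_abs_empFluct_sub_le hlaw hindep n u v ht⟩

/-- Uniform law of large numbers for a Lipschitz class on a box: the strong law at the countably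
many dyadic parameters extends to all parameters by the Lipschitz bound. -/
theorem IsLipschitzClass.ae_eventually_forall_abs_sub_le [IsProbabilityMeasure μ]
    [IsProbabilityMeasure P] (hg : IsLipschitzClass g P L) (hlaw : ∀ i, HasLaw (X i) P μ)
    (hindep : iIndepFun X μ) (R : ℕ) :
    ∀ᵐ ω ∂μ, ∀ ε : ℝ, 0 < ε → ∀ᶠ n : ℕ in atTop, ∀ l, ‖l‖ ≤ R →
      |(n : ℝ)⁻¹ * ∑ i ∈ Finset.range n, g l (X i ω) - ∫ x, g l x ∂P| ≤ ε := by
  classical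
  have hslln : ∀ u, ∀ᵐ ω ∂μ, Tendsto
      (fun n : ℕ => (n : ℝ)⁻¹ * ∑ i ∈ Finset.range n, g u (X i ω)) atTop
      (𝓝 (∫ x, g u x ∂P)) := by
    intro u
    have hcomp : ∀ i, HasLaw (fun ω => g u (X i ω)) (P.map (g u)) μ := fun i =>
      HasLaw.fun_comp ⟨(hg.measurable u).aemeasurable, rfl⟩ (hlaw i)
    have hident : ∀ i, IdentDistrib (fun ω => g u (X i ω)) (fun ω => g u (X 0 ω)) μ μ := fun i =>
      ⟨(hcomp i).aemeasurable, (hcomp 0).aemeasurable, by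
        rw [(hcomp i).map_eq, (hcomp 0).map_eq]⟩
    have hint : Integrable (fun ω => g u (X 0 ω)) μ := by
      have : Integrable (g u) (μ.map (X 0)) := by rw [(hlaw 0).map_eq]; exact hg.integrable u
      exact this.comp_aemeasurable (hlaw 0).aemeasurable
    have hind : iIndepFun (fun i ω => g u (X i ω)) μ :=
      hindep.comp (fun _ => g u) fun _ => hg.measurable u
    have hmean : ∫ ω, g u (X 0 ω) ∂μ = ∫ x, g u x ∂P :=
      (hlaw 0).integral_comp (hg.measurable u).aestronglyMeasurable
    filter_upwards [strong_law_ae_real (fun i ω => g u (X i ω)) hint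
      (fun i j hij => hind.indepFun hij) hident] with ω hω
    rw [← hmean]
    simpa only [div_eq_inv_mul] using hω
  have hgrid : ∀ᵐ ω ∂μ, ∀ m, ∀ u ∈ dyadicGrid ι R m, Tendsto
      (fun n : ℕ => (n : ℝ)⁻¹ * ∑ i ∈ Finset.range n, g u (X i ω)) atTop
      (𝓝 (∫ x, g u x ∂P)) :=
    ae_all_iff.2 fun m => (ae_ball_iff (dyadicGrid ι R m).countable_toSet).2 fun u _ => hslln u
  filter_upwards [hgrid, hg.ae_forall_lipschitz hlaw] with ω hω hLip ε hε
  obtain ⟨m, hm⟩ := exists_pow_lt_of_lt_one (show 0 < ε / (3 * L) by have := hg.pos; positivity)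
    (by norm_num : (1 / 2 : ℝ) < 1)
  have hmL : L * (1 / 2 : ℝ) ^ m ≤ ε / 3 := by
    have := hg.pos
    calc L * (1 / 2 : ℝ) ^ m ≤ L * (ε / (3 * L)) := by gcongr
      _ = ε / 3 := by field_simp
  have hev : ∀ᶠ n : ℕ in atTop, ∀ u ∈ dyadicGrid ι R m,
      |(n : ℝ)⁻¹ * ∑ i ∈ Finset.range n, g u (X i ω) - ∫ x, g u x ∂P| < ε / 3 := by
    rw [Filter.eventually_all_finset]
    intro u hu
    simpa [Real.dist_eq] using Metric.tendsto_nhds.1 (hω m u hu) (ε / 3) (by positivity)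
  filter_upwards [hev, eventually_gt_atTop 0] with n hn hn0 l hl
  set u := dyadicFloor m l
  have hd : L * ‖u - l‖ ≤ ε / 3 :=
    (mul_le_mul_of_nonneg_left (norm_dyadicFloor_sub_le m l) hg.pos.le).trans hmL
  have h1 := hn u (dyadicFloor_mem_dyadicGrid m hl)
  have h2 := (hg.abs_integral_sub_le l u).trans hd
  have hn0' : (0 : ℝ) < n := by exact_mod_cast hn0
  have h3 : |(n : ℝ)⁻¹ * ∑ i ∈ Finset.range n, g u (X i ω)
      - (n : ℝ)⁻¹ * ∑ i ∈ Finset.range n, g l (X i ω)| ≤ ε / 3 := by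
    rw [← mul_sub, ← Finset.sum_sub_distrib, abs_mul, abs_of_pos (inv_pos.2 hn0'),
      inv_mul_le_iff₀ hn0']
    calc _ ≤ ∑ i ∈ Finset.range n, |g u (X i ω) - g l (X i ω)| := Finset.abs_sum_le_sum_abs _ _
      _ ≤ ∑ i ∈ Finset.range n, ε / 3 := Finset.sum_le_sum fun i _ => (hLip i l u).trans hd
      _ = n * (ε / 3) := by simp
  rw [abs_le] at *
  rw [abs_lt] at h1
  constructor <;> linarith [h1.1, h1.2, h2.1, h2.2, h3.1, h3.2]

end

/-! ### Tangents of convex functions -/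

section

variable {k p : ℕ} {φ : EuclideanSpace ℝ (Fin p) → ℝ} {Ψ : (Fin k → ℝ) → ℝ}

lemma bregman_nonneg (hφd : Differentiable ℝ φ) (hφc : ConvexOn ℝ Set.univ φ)
    (x y : EuclideanSpace ℝ (Fin p)) : 0 ≤ bregman φ x y := by
  -- the slope inequality for the convex function `t ↦ φ (y + t (x - y))` on `[0, 1]`
  have hline : ConvexOn ℝ Set.univ (φ ∘ AffineMap.lineMap (k := ℝ) y x) := by
    simpa using hφc.comp_affineMap (AffineMap.lineMap (k := ℝ) y x)
  have hder : HasDerivAt (φ ∘ AffineMap.lineMap (k := ℝ) y x)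
      (inner ℝ (gradient φ y) (x - y)) 0 := by
    rw [inner_gradient_left]
    refine HasFDerivAt.comp_hasDerivAt (0 : ℝ) ?_ AffineMap.hasDerivAt_lineMap
    simpa using (hφd y).hasFDerivAt
  have := hline.le_slope_of_hasDerivAt (Set.mem_univ _) (Set.mem_univ _) zero_lt_one hder
  simp only [slope_def_field, Function.comp, AffineMap.lineMap_apply_one,
    AffineMap.lineMap_apply_zero, sub_zero, div_one] at this
  simp only [bregman]
  linarith

/-- The coefficients `(φ θ - ⟨∇φ θ, θ⟩, ∇φ θ)` of the tangent `φ θ + ⟨∇φ θ, · - θ⟩` of `φ` at `θ`.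
The constant term has index `none`. -/
noncomputable def tangentCoeff (φ : EuclideanSpace ℝ (Fin p) → ℝ) (θ : EuclideanSpace ℝ (Fin p)) :
    Option (Fin p) → ℝ
  | none => φ θ - inner ℝ (gradient φ θ) θ
  | some i => gradient φ θ i

lemma bregman_eq_tangentCoeff (x θ : EuclideanSpace ℝ (Fin p)) :
    bregman φ x θ = φ x - tangentCoeff φ θ none - ∑ i, tangentCoeff φ θ (some i) * x i := by
  have : ∑ i, tangentCoeff φ θ (some i) * x i = inner ℝ (gradient φ θ) x := by
    rw [PiLp.inner_apply]
    simp [tangentCoeff, mul_comm]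
  rw [this, bregman, inner_sub_right, tangentCoeff]
  ring

/-- Either the tangent at `θ` has bounded coefficients, or it lies far below `φ` on the whole
ball. A tangent with a large gradient would exceed `φ`, which is bounded on the ball of radius
`ρ + 1`, unless its values on the ball of radius `ρ` were very negative. -/
lemma exists_forall_norm_tangentCoeff_le_or (hφd : Differentiable ℝ φ)
    (hφc : ConvexOn ℝ Set.univ φ) (ρ C : ℝ) (hρ : 0 ≤ ρ) :
    ∃ R : ℝ, ∀ θ, ‖tangentCoeff φ θ‖ ≤ R ∨ ∀ x, ‖x‖ ≤ ρ → C < bregman φ x θ := by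
  obtain ⟨B, hB⟩ := (isCompact_closedBall
    (0 : EuclideanSpace ℝ (Fin p)) (ρ + 1)).exists_bound_of_continuousOn hφd.continuous.continuousOn
  simp only [mem_closedBall_zero_iff, Real.norm_eq_abs] at hB
  have hB0 : 0 ≤ B := (abs_nonneg _).trans (hB 0 (by simp; linarith))
  set G : ℝ := |C| + 2 * B + 1 with hG
  have hGpos : 0 < G := by have := abs_nonneg C; linarith
  set A : ℝ := |C| + 2 * B + G * ρ + 1 with hA
  refine ⟨max G A, fun θ => ?_⟩
  -- `c + ⟨b, ·⟩` is the tangent at `θ`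
  set b := gradient φ θ with hb
  set c := φ θ - inner ℝ b θ with hc
  have hbr : ∀ x, bregman φ x θ = φ x - c - inner ℝ b x := fun x => by
    rw [bregman, inner_sub_right]; ring
  by_cases hbG : ‖b‖ ≤ G
  · by_cases hcA : -A ≤ c
    · left
      have hc0 : c ≤ A := by
        have h0 := bregman_nonneg hφd hφc 0 θ
        rw [hbr, inner_zero_right] at h0
        have h1 := (abs_le.1 (hB 0 (by simp; linarith))).2
        have := abs_nonneg C
        nlinarith
      refine (pi_norm_le_iff_of_nonneg (hGpos.le.trans (le_max_left _ _))).2 fun i => ?_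
      cases i with
      | none => exact (abs_le.2 ⟨hcA, hc0⟩).trans (le_max_right _ _)
      | some i => exact ((PiLp.norm_apply_le b i).trans hbG).trans (le_max_left _ _)
    · right
      intro x hx
      rw [hbr]
      have h1 := (abs_le.1 (hB x (by linarith))).1
      have h2 : inner ℝ b x ≤ G * ρ :=
        (real_inner_le_norm b x).trans (mul_le_mul hbG hx (norm_nonneg _) hGpos.le)
      have := le_abs_self C
      linarith
  · right
    intro x hx
    rw [not_le] at hbG
    have hbpos : 0 < ‖b‖ := hGpos.trans hbG
    have h1 := bregman_nonneg hφd hφc (x + ‖b‖⁻¹ • b) θ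
    rw [hbr, inner_add_right, inner_smul_right, real_inner_self_eq_norm_sq] at h1
    have h2 : ‖b‖⁻¹ * ‖b‖ ^ 2 = ‖b‖ := by field_simp
    have h3 : ‖x + ‖b‖⁻¹ • b‖ ≤ ρ + 1 := by
      refine (norm_add_le _ _).trans (add_le_add hx ?_)
      rw [norm_smul, norm_inv, norm_norm, inv_mul_cancel₀ hbpos.ne']
    have h4 := (abs_le.1 (hB _ h3)).2
    have h5 := (abs_le.1 (hB x (by linarith))).1
    rw [hbr]
    have := le_abs_self C
    linarith

/-! ### The loss in terms of tangent coefficients -/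

/-- The loss as a function of tangent coefficients `l`, extended to all coefficients by
truncating the differences between `φ` and the affine functions at zero. -/
noncomputable def affineLoss (Ψ : (Fin k → ℝ) → ℝ) (φ : EuclideanSpace ℝ (Fin p) → ℝ)
    (l : Fin k × Option (Fin p) → ℝ) (x : EuclideanSpace ℝ (Fin p)) : ℝ :=
  Ψ fun j => max (φ x - l (j, none) - ∑ i, l (j, some i) * x i) 0

/-- The tangent coefficients of all the centroids. -/
noncomputable def lossCoeff (φ : EuclideanSpace ℝ (Fin p) → ℝ)
    (Θ : Fin k → EuclideanSpace ℝ (Fin p)) :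
    Fin k × Option (Fin p) → ℝ :=
  fun q => tangentCoeff φ (Θ q.1) q.2

lemma norm_lossCoeff_le {Θ : Fin k → EuclideanSpace ℝ (Fin p)} {R : ℝ} (hR : 0 ≤ R)
    (h : ∀ j, ‖tangentCoeff φ (Θ j)‖ ≤ R) : ‖lossCoeff φ Θ‖ ≤ R :=
  (pi_norm_le_iff_of_nonneg hR).2 fun q => (norm_le_pi_norm _ q.2).trans (h q.1)

lemma loss_eq_affineLoss (hφd : Differentiable ℝ φ) (hφc : ConvexOn ℝ Set.univ φ)
    (Θ : Fin k → EuclideanSpace ℝ (Fin p)) : loss Ψ φ Θ = affineLoss Ψ φ (lossCoeff φ Θ) := by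
  funext x
  simp only [loss, affineLoss, lossCoeff]
  congr 1
  funext j
  rw [← bregman_eq_tangentCoeff, max_eq_left (bregman_nonneg hφd hφc _ _)]

lemma measurable_lossCoeff (hφd : Differentiable ℝ φ) :
    Measurable (lossCoeff (k := k) φ) := by
  have hgrad : Measurable (gradient φ) :=
    (InnerProductSpace.toDual ℝ (EuclideanSpace ℝ (Fin p))).symm.continuous.measurable.comp
      (measurable_fderiv ℝ φ)
  refine measurable_pi_lambda _ fun q => ?_
  obtain ⟨j, i⟩ := q
  have hj : Measurable fun Θ : Fin k → EuclideanSpace ℝ (Fin p) => Θ j := measurable_pi_apply j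
  cases i with
  | none =>
    exact (hφd.continuous.measurable.comp hj).sub ((hgrad.comp hj).inner hj)
  | some i =>
    exact ((EuclideanSpace.proj (𝕜 := ℝ) i).continuous.measurable.comp (hgrad.comp hj))

/-- Truncation at zero turns the Lipschitz property of `Ψ` on the orthant into a global one. -/
lemma abs_truncate_sub_le {τ : ℝ}
    (hΨL : ∀ x y : Fin k → ℝ, 0 ≤ x → 0 ≤ y → |Ψ x - Ψ y| ≤ τ * ∑ j, |x j - y j|)
    (x y : Fin k → ℝ) :
    |Ψ (fun j => max (x j) 0) - Ψ (fun j => max (y j) 0)| ≤ |τ| * ∑ j, |x j - y j| := by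
  refine (hΨL _ _ (fun j => le_max_right _ _) (fun j => le_max_right _ _)).trans ?_
  refine (mul_le_mul_of_nonneg_right (le_abs_self τ)
    (Finset.sum_nonneg fun _ _ => abs_nonneg _)).trans ?_
  exact mul_le_mul_of_nonneg_left (Finset.sum_le_sum fun j _ => abs_max_sub_max_le_abs _ _ _)
    (abs_nonneg _)

lemma continuous_affineLoss {τ : ℝ}
    (hΨL : ∀ x y : Fin k → ℝ, 0 ≤ x → 0 ≤ y → |Ψ x - Ψ y| ≤ τ * ∑ j, |x j - y j|)
    (hφ : Continuous φ) (l : Fin k × Option (Fin p) → ℝ) : Continuous (affineLoss Ψ φ l) := by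
  have hΨc : Continuous fun u : Fin k → ℝ => Ψ fun j => max (u j) 0 := by
    refine continuous_of_abs_sub_le (L := |τ| * k) fun u v => ?_
    refine (abs_truncate_sub_le hΨL v u).trans ?_
    rw [mul_assoc]
    refine mul_le_mul_of_nonneg_left ?_ (abs_nonneg _)
    refine (Finset.sum_le_sum fun j _ => norm_le_pi_norm (v - u) j).trans ?_
    simp
  have hu : Continuous fun (x : EuclideanSpace ℝ (Fin p)) (j : Fin k) =>
      φ x - l (j, none) - ∑ i, l (j, some i) * x i := by fun_prop
  exact hΨc.comp hu

lemma abs_affineLoss_sub_le {τ : ℝ}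
    (hΨL : ∀ x y : Fin k → ℝ, 0 ≤ x → 0 ≤ y → |Ψ x - Ψ y| ≤ τ * ∑ j, |x j - y j|) {ρ : ℝ}
    {x : EuclideanSpace ℝ (Fin p)} (hx : ‖x‖ ≤ ρ) (u v : Fin k × Option (Fin p) → ℝ) :
    |affineLoss Ψ φ v x - affineLoss Ψ φ u x| ≤ (|τ| * (k * (1 + p * ρ))) * ‖v - u‖ := by
  refine (abs_truncate_sub_le hΨL _ _).trans ?_
  rw [mul_assoc]
  refine mul_le_mul_of_nonneg_left ?_ (abs_nonneg _)
  have hj : ∀ j : Fin k, |φ x - v (j, none) - ∑ i, v (j, some i) * x i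
      - (φ x - u (j, none) - ∑ i, u (j, some i) * x i)| ≤ (1 + p * ρ) * ‖v - u‖ := by
    intro j
    have h0 : φ x - v (j, none) - ∑ i, v (j, some i) * x i
        - (φ x - u (j, none) - ∑ i, u (j, some i) * x i)
        = -((v - u) (j, none) + ∑ i, (v - u) (j, some i) * x i) := by
      simp only [Pi.sub_apply, sub_mul, Finset.sum_sub_distrib]; ring
    rw [h0, abs_neg]
    refine (abs_add_le _ _).trans ?_
    rw [add_mul, one_mul]
    refine add_le_add (norm_le_pi_norm (v - u) _) ?_
    calc _ ≤ ∑ i, |(v - u) (j, some i) * x i| := Finset.abs_sum_le_sum_abs _ _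
      _ ≤ ∑ i : Fin p, ρ * ‖v - u‖ := by
        refine Finset.sum_le_sum fun i _ => ?_
        rw [abs_mul, mul_comm]
        exact mul_le_mul ((PiLp.norm_apply_le x i).trans hx) (norm_le_pi_norm (v - u) _)
          (abs_nonneg _) ((norm_nonneg _).trans hx)
      _ = p * ρ * ‖v - u‖ := by simp [mul_assoc]
  refine (Finset.sum_le_sum fun j _ => hj j).trans ?_
  simp [mul_assoc]

lemma isLipschitzClass_affineLoss {P : Measure (EuclideanSpace ℝ (Fin p))}
    [IsProbabilityMeasure P] {τ : ℝ}
    (hΨL : ∀ x y : Fin k → ℝ, 0 ≤ x → 0 ≤ y → |Ψ x - Ψ y| ≤ τ * ∑ j, |x j - y j|)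
    (hφ : Continuous φ) {ρ : ℝ} (hρ : 0 ≤ ρ) (hP : ∀ᵐ x ∂P, ‖x‖ ≤ ρ) :
    IsLipschitzClass (affineLoss Ψ φ) P (|τ| * (k * (1 + p * ρ)) + 1) where
  pos := by positivity
  measurable l := (continuous_affineLoss hΨL hφ l).measurable
  integrable l := by
    obtain ⟨B, hB⟩ := (isCompact_closedBall
      (0 : EuclideanSpace ℝ (Fin p)) ρ).exists_bound_of_continuousOn
      (continuous_affineLoss hΨL hφ l).continuousOn
    refine Integrable.of_bound (continuous_affineLoss hΨL hφ l).aestronglyMeasurable B ?_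
    filter_upwards [hP] with x hx using hB x (by simpa using hx)
  lipschitz := by
    filter_upwards [hP] with x hx u v
    refine (abs_affineLoss_sub_le hΨL hx u v).trans ?_
    exact mul_le_mul_of_nonneg_right (by linarith) (norm_nonneg _)

/-! ### The cube and the permutation-invariant distance -/

lemma isClosed_cube (p : ℕ) (M : ℝ) : IsClosed (cube p M) := by
  have : cube p M = ⋂ i, (fun x : EuclideanSpace ℝ (Fin p) => x i) ⁻¹' Set.Icc (-M) M := by
    ext x; simp [cube]
  rw [this]
  exact isClosed_iInter fun i => isClosed_Icc.preimage (by fun_prop)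

lemma exists_norm_le_of_mem_cube (p : ℕ) (M : ℝ) :
    ∃ ρ : ℝ, ∀ x ∈ cube p M, ‖x‖ ≤ ρ := by
  refine ⟨√(∑ _i : Fin p, M ^ 2), fun x hx => ?_⟩
  rw [EuclideanSpace.norm_eq]
  refine Real.sqrt_le_sqrt (Finset.sum_le_sum fun i _ => ?_)
  rw [Real.norm_eq_abs, sq_abs]
  have := hx i
  exact sq_le_sq' this.1 this.2

lemma diss_nonneg (Θ₁ Θ₂ : Fin k → EuclideanSpace ℝ (Fin p)) : 0 ≤ diss Θ₁ Θ₂ :=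
  Real.iInf_nonneg fun _ => Real.sqrt_nonneg _

lemma exists_perm_of_diss_le {Θ₁ Θ₂ : Fin k → EuclideanSpace ℝ (Fin p)} {η : ℝ}
    (h : diss Θ₁ Θ₂ ≤ η) : ∃ σ : Equiv.Perm (Fin k), ∀ j, ‖Θ₁ j - Θ₂ (σ j)‖ ≤ η := by
  obtain ⟨σ, hσ⟩ := exists_eq_ciInf_of_finite
    (f := fun σ : Equiv.Perm (Fin k) => √(∑ j, ‖Θ₁ j - Θ₂ (σ j)‖ ^ 2))
  refine ⟨σ, fun j => ?_⟩
  calc ‖Θ₁ j - Θ₂ (σ j)‖ = √(‖Θ₁ j - Θ₂ (σ j)‖ ^ 2) := (Real.sqrt_sq (norm_nonneg _)).symm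
    _ ≤ √(∑ j, ‖Θ₁ j - Θ₂ (σ j)‖ ^ 2) := Real.sqrt_le_sqrt
        (Finset.single_le_sum (f := fun j => ‖Θ₁ j - Θ₂ (σ j)‖ ^ 2)
          (fun _ _ => sq_nonneg _) (Finset.mem_univ j))
    _ ≤ η := hσ.trans_le h

lemma diss_eq_zero_of_subsingleton [Subsingleton (EuclideanSpace ℝ (Fin p))]
    (Θ₁ Θ₂ : Fin k → EuclideanSpace ℝ (Fin p)) : diss Θ₁ Θ₂ = 0 := by
  have h : ∀ i j, ‖Θ₁ i - Θ₂ j‖ = 0 := fun i j => by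
    rw [Subsingleton.elim (Θ₁ i) (Θ₂ j), sub_self, norm_zero]
  simp [diss, h]

lemma measurable_diss (Θs : Fin k → EuclideanSpace ℝ (Fin p)) :
    Measurable fun Θ => diss Θ Θs :=
  Measurable.iInf fun σ => (by fun_prop : Continuous fun Θ : Fin k → EuclideanSpace ℝ (Fin p) =>
    √(∑ j, ‖Θ j - Θs (σ j)‖ ^ 2)).measurable

end

/-! ### Strong consistency -/

section

variable {k p : ℕ} {φ : EuclideanSpace ℝ (Fin p) → ℝ} {Ψ : (Fin k → ℝ) → ℝ}

/-- Replacing by `θ₀` the centroids whose tangent coefficients are large does not increase the loss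
on the ball of radius `ρ`. -/
lemma exists_forall_exists_replacement (hφd : Differentiable ℝ φ) (hφc : ConvexOn ℝ Set.univ φ)
    (hΨ : IsAggregation Ψ) (θ₀ : EuclideanSpace ℝ (Fin p)) {ρ : ℝ} (hρ : 0 ≤ ρ) :
    ∃ R : ℝ, ∀ Θ : Fin k → EuclideanSpace ℝ (Fin p), ∃ Θ' : Fin k → EuclideanSpace ℝ (Fin p),
      ‖lossCoeff φ Θ'‖ ≤ R ∧ (∀ j, Θ' j = Θ j ∨ Θ' j = θ₀) ∧
        ∀ x, ‖x‖ ≤ ρ → loss Ψ φ Θ' x ≤ loss Ψ φ Θ x := by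
  classical
  have hcont : Continuous fun x => bregman φ x θ₀ := by
    have := hφd.continuous
    unfold bregman
    fun_prop
  obtain ⟨C, hC⟩ := (isCompact_closedBall
    (0 : EuclideanSpace ℝ (Fin p)) ρ).exists_bound_of_continuousOn hcont.continuousOn
  simp only [mem_closedBall_zero_iff, Real.norm_eq_abs] at hC
  obtain ⟨R, hR⟩ := exists_forall_norm_tangentCoeff_le_or hφd hφc ρ C hρ
  refine ⟨max R ‖tangentCoeff φ θ₀‖, fun Θ =>
    ⟨fun j => if ‖tangentCoeff φ (Θ j)‖ ≤ R then Θ j else θ₀, ?_, ?_, ?_⟩⟩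
  · refine norm_lossCoeff_le ((norm_nonneg _).trans (le_max_right _ _)) fun j => ?_
    split_ifs with h
    · exact h.trans (le_max_left _ _)
    · exact le_max_right _ _
  · intro j
    dsimp only
    split_ifs
    · exact Or.inl rfl
    · exact Or.inr rfl
  · intro x hx
    refine hΨ.mono _ _ (fun j => bregman_nonneg hφd hφc _ _) fun j => ?_
    dsimp only
    split_ifs with h
    · exact le_rfl
    · exact ((le_abs_self _).trans (hC x hx)).trans ((hR (Θ j)).resolve_left h x hx).le

/-- Parameters at bounded distance from `Θs` have bounded tangent coefficients. -/
lemma exists_forall_norm_lossCoeff_le_of_diss_le (hφd : Differentiable ℝ φ)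
    (hφc : ConvexOn ℝ Set.univ φ) (Θs : Fin k → EuclideanSpace ℝ (Fin p)) (η : ℝ) :
    ∃ R : ℝ, ∀ Θ, diss Θ Θs ≤ η → ‖lossCoeff φ Θ‖ ≤ R := by
  obtain ⟨R, hR⟩ := exists_forall_norm_tangentCoeff_le_or hφd hφc (‖Θs‖ + |η|) 0 (by positivity)
  refine ⟨max R 0, fun Θ hΘ => norm_lossCoeff_le (le_max_right _ _) fun j => ?_⟩
  obtain ⟨σ, hσ⟩ := exists_perm_of_diss_le hΘ
  refine ((hR (Θ j)).resolve_right fun h => ?_).trans (le_max_left _ _)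
  -- the tangent at `Θ j` meets `φ` at `Θ j` itself
  refine absurd (h (Θ j) ?_) (by simp [bregman])
  have := norm_le_norm_add_norm_sub' (Θ j) (Θs (σ j))
  linarith [hσ j, norm_le_pi_norm Θs (σ j), le_abs_self η]

lemma exists_forall_lt_norm_sub [Nontrivial (EuclideanSpace ℝ (Fin p))]
    (Θs : Fin k → EuclideanSpace ℝ (Fin p)) : ∃ θ₀, ∀ j, 1 < ‖θ₀ - Θs j‖ := by
  obtain ⟨θ₀, h⟩ := NormedSpace.exists_lt_norm ℝ (EuclideanSpace ℝ (Fin p)) (‖Θs‖ + 1)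
  refine ⟨θ₀, fun j => ?_⟩
  have := norm_le_norm_add_norm_sub' θ₀ (Θs j)
  linarith [norm_le_pi_norm Θs j]

end

section

variable {k p : ℕ} {φ : EuclideanSpace ℝ (Fin p) → ℝ} {Ψ : (Fin k → ℝ) → ℝ}
  {Ω : Type*} [MeasurableSpace Ω] {μ : Measure Ω} {P : Measure (EuclideanSpace ℝ (Fin p))}
  {X : ℕ → Ω → EuclideanSpace ℝ (Fin p)} {L : ℝ}
  {Θs : Fin k → EuclideanSpace ℝ (Fin p)} {Θhat : ℕ → Ω → Fin k → EuclideanSpace ℝ (Fin p)}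

/-- Strong consistency. An empirical minimizer is compared with the parameter obtained by moving
its centroids with large tangent coefficients to a point `θ₀` far from all the true centroids. The
new parameter lies in a class that obeys the uniform law of large numbers, so it is close to `Θs`;
hence none of its centroids is `θ₀`, and it is the minimizer itself. -/
theorem ae_tendsto_diss [IsProbabilityMeasure μ] [IsProbabilityMeasure P]
    (hφd : Differentiable ℝ φ) (hφc : ConvexOn ℝ Set.univ φ) (hΨ : IsAggregation Ψ)
    (hg : IsLipschitzClass (affineLoss Ψ φ) P L) {ρ : ℝ} (hρ : 0 ≤ ρ) (hP : ∀ᵐ x ∂P, ‖x‖ ≤ ρ)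
    (hlaw : ∀ i, HasLaw (X i) P μ) (hindep : iIndepFun X μ)
    (hident : ∀ η : ℝ, 0 < η → ∃ ε : ℝ, 0 < ε ∧ ∀ Θ, η < diss Θ Θs →
      risk Ψ φ P Θs + ε < risk Ψ φ P Θ)
    (hΘhat : ∀ n, ∀ᵐ ω ∂μ, ∀ Θ, empRisk Ψ φ n (fun i => X i ω) (Θhat n ω) ≤
      empRisk Ψ φ n (fun i => X i ω) Θ) :
    ∀ᵐ ω ∂μ, Tendsto (fun n => diss (Θhat n ω) Θs) atTop (𝓝 0) := by
  -- for `p = 0` there is no room for a point `θ₀`, and all centroids coincide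
  rcases subsingleton_or_nontrivial (EuclideanSpace ℝ (Fin p)) with hsub | hnon
  · simp [diss_eq_zero_of_subsingleton]
  obtain ⟨θ₀, hθ₀⟩ := exists_forall_lt_norm_sub Θs
  obtain ⟨R, hR⟩ := exists_forall_exists_replacement (k := k) hφd hφc hΨ θ₀ hρ
  obtain ⟨N, hN⟩ := exists_nat_ge (max R ‖lossCoeff φ Θs‖)
  have hXρ : ∀ᵐ ω ∂μ, ∀ i, ‖X i ω‖ ≤ ρ := ae_all_iff.2 fun i =>
    ae_of_ae_map (hlaw i).aemeasurable (p := fun x => ‖x‖ ≤ ρ) (by rwa [(hlaw i).map_eq])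
  filter_upwards [hg.ae_eventually_forall_abs_sub_le hlaw hindep N, hXρ, ae_all_iff.2 hΘhat]
    with ω hulln hX hmin
  rw [Metric.tendsto_nhds]
  intro η hη
  obtain ⟨ε, hε, hsep⟩ := hident (min (η / 2) 1) (by positivity)
  filter_upwards [hulln (ε / 2) (by positivity)] with n hn
  have hdev : ∀ Θ, ‖lossCoeff φ Θ‖ ≤ N →
      |empRisk Ψ φ n (fun i => X i ω) Θ - risk Ψ φ P Θ| ≤ ε / 2 := fun Θ hΘ => by
    simpa only [empRisk, risk, loss_eq_affineLoss hφd hφc] using hn _ hΘ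
  obtain ⟨Θ', hΘ'R, hΘ'or, hΘ'le⟩ := hR (Θhat n ω)
  have hle : empRisk Ψ φ n (fun i => X i ω) Θ' ≤ empRisk Ψ φ n (fun i => X i ω) (Θhat n ω) :=
    mul_le_mul_of_nonneg_left (Finset.sum_le_sum fun i _ => hΘ'le _ (hX i)) (by positivity)
  have h1 := abs_le.1 (hdev Θ' (hΘ'R.trans ((le_max_left _ _).trans hN)))
  have h2 := abs_le.1 (hdev Θs ((le_max_right _ _).trans hN))
  have hdiss : diss Θ' Θs ≤ min (η / 2) 1 := by
    by_contra hlt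
    linarith [hsep Θ' (not_le.1 hlt), hmin n Θs]
  obtain ⟨σ, hσ⟩ := exists_perm_of_diss_le hdiss
  have heq : Θ' = Θhat n ω := by
    funext j
    refine (hΘ'or j).resolve_right fun h => ?_
    have := (hσ j).trans (min_le_right _ _)
    rw [h] at this
    linarith [hθ₀ (σ j)]
  rw [heq] at hdiss
  rw [Real.dist_eq, sub_zero, abs_of_nonneg (diss_nonneg _ _)]
  linarith [min_le_left (η / 2) 1]

/-! ### Tightness of the excess risk -/

/-- The excess risk of an empirical minimizer is at most an increment of the empirical process. -/
lemma sqrt_mul_risk_sub_le (hφd : Differentiable ℝ φ) (hφc : ConvexOn ℝ Set.univ φ) (n : ℕ)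
    {Ω : Type*} {X : ℕ → Ω → EuclideanSpace ℝ (Fin p)} {ω : Ω}
    {Θ : Fin k → EuclideanSpace ℝ (Fin p)}
    (hmin : empRisk Ψ φ n (fun i => X i ω) Θ ≤ empRisk Ψ φ n (fun i => X i ω) Θs) :
    √n * (risk Ψ φ P Θ - risk Ψ φ P Θs)
      ≤ empFluct (affineLoss Ψ φ) P X n (lossCoeff φ Θs) ω
        - empFluct (affineLoss Ψ φ) P X n (lossCoeff φ Θ) ω := by
  have hproc : ∀ Θ, empFluct (affineLoss Ψ φ) P X n (lossCoeff φ Θ) ω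
      = √n * (empRisk Ψ φ n (fun i => X i ω) Θ - risk Ψ φ P Θ) := by
    intro Θ
    rcases Nat.eq_zero_or_pos n with rfl | hn
    · simp [empFluct]
    have hn0 : (0 : ℝ) < n := by exact_mod_cast hn
    have hs : √(n : ℝ) ≠ 0 := (Real.sqrt_pos.2 hn0).ne'
    simp only [empFluct, empRisk, risk, ← loss_eq_affineLoss hφd hφc, Finset.sum_sub_distrib,
      Finset.sum_const, Finset.card_range, nsmul_eq_mul]
    have h2 : (n : ℝ) = √n * √n := (Real.mul_self_sqrt hn0.le).symm
    have h3 : (√(n : ℝ))⁻¹ * n = √n := by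
      nth_rewrite 2 [h2]; field_simp
    have h4 : (√(n : ℝ))⁻¹ = √n * (n : ℝ)⁻¹ := by
      nth_rewrite 3 [h2]; field_simp
    rw [mul_sub, ← mul_assoc, h3, h4]
    ring
  rw [hproc, hproc]
  nlinarith [mul_le_mul_of_nonneg_left hmin (Real.sqrt_nonneg (n : ℝ))]

lemma measurable_risk [IsProbabilityMeasure P] (hφd : Differentiable ℝ φ)
    (hφc : ConvexOn ℝ Set.univ φ) (hg : IsLipschitzClass (affineLoss Ψ φ) P L) :
    Measurable (risk Ψ φ P) := by
  have : risk Ψ φ P = (fun l => ∫ x, affineLoss Ψ φ l x ∂P) ∘ lossCoeff φ := by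
    funext Θ
    simp only [risk, loss_eq_affineLoss hφd hφc, Function.comp]
  rw [this]
  exact (continuous_of_abs_sub_le hg.abs_integral_sub_le).measurable.comp
    (measurable_lossCoeff hφd)

lemma exists_measure_lt_abs_le [IsFiniteMeasure μ] {f : Ω → ℝ} (hf : Measurable f) {δ : ℝ}
    (hδ : 0 < δ) : ∃ C : ℝ, μ {ω | C < |f ω|} ≤ ENNReal.ofReal δ := by
  have h := tendsto_measure_iInter_atTop (μ := μ) (s := fun n : ℕ => {ω | (n : ℝ) < |f ω|})
    (fun n => (measurableSet_lt measurable_const hf.abs).nullMeasurableSet)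
    (fun m n hmn ω (hω : (n : ℝ) < |f ω|) =>
      (lt_of_le_of_lt (Nat.cast_le.2 hmn) hω : (m : ℝ) < |f ω|)) ⟨0, measure_ne_top _ _⟩
  have hempty : ⋂ n : ℕ, {ω | (n : ℝ) < |f ω|} = ∅ := by
    ext ω
    simp only [Set.mem_iInter, Set.mem_ofPred_eq, Set.mem_empty_iff_false, iff_false, not_forall,
      not_lt]
    exact exists_nat_ge _
  rw [hempty, measure_empty] at h
  obtain ⟨n, hn⟩ := (h.eventually_le_const (ENNReal.ofReal_pos.2 hδ)).exists
  exact ⟨n, hn⟩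

/-- For measurable functions, tightness may be checked along a tail of the sequence. -/
lemma isBigOP_of_eventually [IsFiniteMeasure μ] {Y : ℕ → Ω → ℝ} (hY : ∀ n, Measurable (Y n))
    {a : ℕ → ℝ} (h : ∀ δ : ℝ, 0 < δ → ∃ C : ℝ, ∀ᶠ n in atTop,
      μ {ω | C < |Y n ω / a n|} ≤ ENNReal.ofReal δ) : IsBigOP μ Y a := by
  intro δ hδ
  obtain ⟨C, hC⟩ := h δ hδ
  obtain ⟨N, hN⟩ := eventually_atTop.1 hC
  choose D hD using fun n => exists_measure_lt_abs_le (μ := μ) ((hY n).div_const (a n)) hδ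
  obtain ⟨B, hB⟩ := ((Finset.range N).image D).exists_le
  refine ⟨max C B, fun n => ?_⟩
  rcases lt_or_ge n N with hn | hn
  · refine (measure_mono fun ω hω => ?_).trans (hD n)
    exact ((hB _ (Finset.mem_image_of_mem D (Finset.mem_range.2 hn))).trans
      (le_max_right _ _)).trans_lt hω
  · refine (measure_mono fun ω hω => ?_).trans (hN n hn)
    exact (le_max_left C B).trans_lt hω

/-- The parametric rate: by consistency the minimizers have bounded tangent coefficients with high
probability, and then the excess risk is controlled by the empirical process on a box. -/
theorem isBigOP_excess_risk [IsProbabilityMeasure μ] [IsProbabilityMeasure P]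
    (hφd : Differentiable ℝ φ) (hφc : ConvexOn ℝ Set.univ φ)
    (hg : IsLipschitzClass (affineLoss Ψ φ) P L)
    (hlaw : ∀ i, HasLaw (X i) P μ) (hindep : iIndepFun X μ)
    (hΘs : ∀ Θ, risk Ψ φ P Θs ≤ risk Ψ φ P Θ) (hΘm : ∀ n, Measurable (Θhat n))
    (hΘhat : ∀ n, ∀ᵐ ω ∂μ, ∀ Θ, empRisk Ψ φ n (fun i => X i ω) (Θhat n ω) ≤
      empRisk Ψ φ n (fun i => X i ω) Θ)
    (hcons : ∀ᵐ ω ∂μ, Tendsto (fun n => diss (Θhat n ω) Θs) atTop (𝓝 0)) :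
    IsBigOP μ (fun n ω => |risk Ψ φ P (Θhat n ω) - risk Ψ φ P Θs|)
      (fun n => (n : ℝ) ^ (-(1 / 2) : ℝ)) := by
  have hrisk := measurable_risk hφd hφc hg
  refine isBigOP_of_eventually
    (fun n => ((hrisk.comp (hΘm n)).sub_const _).abs) fun δ hδ => ?_
  obtain ⟨R, hR⟩ := exists_forall_norm_lossCoeff_le_of_diss_le hφd hφc Θs 1
  obtain ⟨N, hN⟩ := exists_nat_ge (max (max R ‖lossCoeff φ Θs‖) 1)
  have hN1 : 1 ≤ N := by exact_mod_cast (le_max_right _ _).trans hN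
  obtain ⟨C, hC⟩ := hg.exists_forall_measure_exists_lt_abs_empFluct_sub_le hlaw hindep hN1
    (half_pos hδ)
  have hmeas : TendstoInMeasure μ (fun n ω => diss (Θhat n ω) Θs) atTop fun _ => 0 :=
    tendstoInMeasure_of_tendsto_ae
      (fun n => ((measurable_diss Θs).comp (hΘm n)).aestronglyMeasurable) hcons
  have hfar := (tendstoInMeasure_iff_norm.1 hmeas 1 one_pos).eventually_le_const
    (ENNReal.ofReal_pos.2 (half_pos hδ))
  refine ⟨2 * C, ?_⟩
  filter_upwards [hfar] with n hn
  set Y := empFluct (affineLoss Ψ φ) P X n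
  have hsub : {ω | 2 * C < |(|risk Ψ φ P (Θhat n ω) - risk Ψ φ P Θs|) /
      (n : ℝ) ^ (-(1 / 2) : ℝ)|} ≤ᵐ[μ]
      ({ω | 1 ≤ ‖diss (Θhat n ω) Θs - 0‖} ∪ {ω | ∃ l, ‖l‖ ≤ N ∧ C < |Y l ω - Y 0 ω|} : Set Ω) := by
    filter_upwards [hΘhat n] with ω hmin hω
    change 2 * C < _ at hω
    by_contra hnot
    have hnot' : ¬ (1 ≤ ‖diss (Θhat n ω) Θs - 0‖ ∨ ∃ l, ‖l‖ ≤ N ∧ C < |Y l ω - Y 0 ω|) := hnot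
    push Not at hnot'
    obtain ⟨hnear, hsmall⟩ := hnot'
    rw [sub_zero, Real.norm_eq_abs, abs_of_nonneg (diss_nonneg _ _)] at hnear
    have h1 := abs_le.1 (hsmall (lossCoeff φ (Θhat n ω))
      ((hR _ hnear.le).trans ((le_max_left _ _).trans ((le_max_left _ _).trans hN))))
    have h2 := abs_le.1 (hsmall (lossCoeff φ Θs)
      ((le_max_right _ _).trans ((le_max_left _ _).trans hN)))
    have h3 := sqrt_mul_risk_sub_le (P := P) hφd hφc n (hmin Θs)
    have h4 : (|risk Ψ φ P (Θhat n ω) - risk Ψ φ P Θs|) / (n : ℝ) ^ (-(1 / 2) : ℝ)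
        = √n * (risk Ψ φ P (Θhat n ω) - risk Ψ φ P Θs) := by
      rw [abs_of_nonneg (sub_nonneg.2 (hΘs _)), Real.rpow_neg (Nat.cast_nonneg n),
        ← Real.sqrt_eq_rpow, div_inv_eq_mul, mul_comm]
    rw [h4, abs_of_nonneg (mul_nonneg (Real.sqrt_nonneg _) (sub_nonneg.2 (hΘs _)))] at hω
    linarith
  calc _ ≤ _ := measure_mono_ae hsub
    _ ≤ _ := measure_union_le _ _
    _ ≤ ENNReal.ofReal (δ / 2) + ENNReal.ofReal (δ / 2) := add_le_add hn (hC n)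
    _ = ENNReal.ofReal δ := by
        rw [← ENNReal.ofReal_add (by positivity) (by positivity), add_halves]

end

end CenterClustering

theorem mainTheorem2 {k p : ℕ} {Ω : Type*} [MeasurableSpace Ω]
    (μ : Measure Ω) [IsProbabilityMeasure μ]
    (φ : EuclideanSpace ℝ (Fin p) → ℝ) (hφd : Differentiable ℝ φ) (hφc : ConvexOn ℝ Set.univ φ)
    (Ψ : (Fin k → ℝ) → ℝ) (hΨ : CenterClustering.IsAggregation Ψ)
    -- the data: i.i.d. with law `P` supported in the cube `[-M, M]^p`
    (M : ℝ) (P : Measure (EuclideanSpace ℝ (Fin p))) [IsProbabilityMeasure P]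
    (hP : P (CenterClustering.cube p M) = 1)
    (X : ℕ → Ω → EuclideanSpace ℝ (Fin p))
    (hlaw : ∀ i, HasLaw (X i) P μ) (hindep : iIndepFun X μ)
    -- `Ψ` is Lipschitz on the nonnegative orthant for the `ℓ¹` norm
    (τ : ℝ) (hΨL : ∀ x y : Fin k → ℝ, 0 ≤ x → 0 ≤ y → |Ψ x - Ψ y| ≤ τ * ∑ j, |x j - y j|)
    -- the gradient of `φ` is Lipschitz on the cube
    (H : ℝ) (hH : 0 ≤ H)
    (hφL : ∀ x ∈ CenterClustering.cube p M, ∀ y ∈ CenterClustering.cube p M,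
      ‖gradient φ x - gradient φ y‖ ≤ H * ‖x - y‖)
    -- a global minimizer of the population risk
    (Θs : Fin k → EuclideanSpace ℝ (Fin p))
    (hΘs : ∀ Θ, CenterClustering.risk Ψ φ P Θs ≤ CenterClustering.risk Ψ φ P Θ)
    -- identifiability
    (hident : ∀ η : ℝ, 0 < η → ∃ ε : ℝ, 0 < ε ∧ ∀ Θ : Fin k → EuclideanSpace ℝ (Fin p),
      η < CenterClustering.diss Θ Θs →
        CenterClustering.risk Ψ φ P Θs + ε < CenterClustering.risk Ψ φ P Θ)
    -- global minimizers of the empirical risks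
    (Θhat : ℕ → Ω → Fin k → EuclideanSpace ℝ (Fin p)) (hΘm : ∀ n, Measurable (Θhat n))
    (hΘhat : ∀ n, ∀ᵐ ω ∂μ, ∀ Θ, CenterClustering.empRisk Ψ φ n (fun i => X i ω) (Θhat n ω) ≤
      CenterClustering.empRisk Ψ φ n (fun i => X i ω) Θ) :
    (∀ᵐ ω ∂μ, Tendsto (fun n => CenterClustering.diss (Θhat n ω) Θs) atTop (𝓝 0)) ∧
    CenterClustering.IsBigOP μ
      (fun n ω => |CenterClustering.risk Ψ φ P (Θhat n ω) - CenterClustering.risk Ψ φ P Θs|)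
      (fun n => (n : ℝ) ^ (-(1 / 2) : ℝ)) := by
  obtain ⟨ρ₀, hρ₀⟩ := CenterClustering.exists_norm_le_of_mem_cube p M
  have hPρ : ∀ᵐ x ∂P, ‖x‖ ≤ max ρ₀ 0 := by
    have hcube : CenterClustering.cube p M ∈ ae P :=
      (mem_ae_iff_prob_eq_one
        (CenterClustering.isClosed_cube p M).measurableSet).2 hP
    filter_upwards [hcube] with x hx using (hρ₀ x hx).trans (le_max_left _ _)
  have hg := CenterClustering.isLipschitzClass_affineLoss hΨL hφd.continuous
    (le_max_right ρ₀ 0) hPρ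
  have hcons := CenterClustering.ae_tendsto_diss hφd hφc hΨ hg (le_max_right ρ₀ 0) hPρ hlaw
    hindep hident hΘhat
  exact ⟨hcons, CenterClustering.isBigOP_excess_risk hφd hφc hg hlaw hindep hΘs hΘm hΘhat hcons⟩
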